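/- Let $k$ be a field (of any characteristic), let $V$ be a $k$-vector space of finite dimension $n$, and let $A=S(V)$ be its symmetric algebra, viewed as the quadratic algebra $A=T(V)/(R)$ with $R\subseteq V\otimes V$ spanned by the elements $x\otimes y-y\otimes x$ $(x,y\in V)$. Put $W_0=k$, $W_1=V$ and, for $p\ge 2$, $W_p=\bigcap_{i+2+j=p}V^{\otimes i}\otimes R\otimes V^{\otimes j}\subseteq V^{\otimes p}$, and write elements of $W_p$ as (sums of) products $x_1\cdots x_p$. For $p\ge 0$ let $HK^p(A)$ be the $p$-th Koszul cohomology of $A$, that is, the cohomology of the complex of spaces $\mathrm{Hom}_k(W_p,A)$ with differential $$b_K(f)(x_1\cdots x_{p+1})=f(x_1\cdots x_p)\,x_{p+1}-(-1)^p\,x_1\,f(x_2\cdots x_{p+1}).$$ For $f\in \mathrm{Hom}_k(W_p,A)$ and $g\in\mathrm{Hom}_k(W_q,A)$ let $(f\smile g)(x_1\cdots x_{p+q})=(-1)^{pq}f(x_1\cdots x_p)\,g(x_{p+1}\cdots x_{p+q})$, and let $e_A\in \mathrm{Hom}_k(V,A)$ be the cocycle $e_A(x)=x$. The map $\partial_\smile:HK^p(A)\to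 HK^{p+1}(A)$, $[f]\mapsto[e_A\smile f]$, satisfies $\partial_\smile^2=0$; let $HK_{hi}^p(A)$ be the $p$-th cohomology of $(HK^\bullet(A),\partial_\smile)$ (the higher Koszul cohomology of $A$). Then, as $k$-vector spaces, $$HK_{hi}^n(A)\cong k,\qquad HK_{hi}^p(A)=0\quad\text{for all } p\ge 0,\ p\neq n.$$ -/

import Mathlib

open scoped TensorProduct

noncomputable section

namespace KoszulCalculus

universe u v w

section TensorAlgebraFacts

variable (k : Type u) (V : Type v) [Field k] [AddCommGroup V] [Module k V]

/-- `V^{⊗p}`, as the weight `p` component of the tensor algebra `T(V)`. -/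
abbrev tpow (p : ℕ) : Submodule k (TensorAlgebra k V) :=
  (LinearMap.range (TensorAlgebra.ι k : V →ₗ[k] TensorAlgebra k V)) ^ p

lemma range_toTensorAlgebra (p : ℕ) :
    LinearMap.range (TensorPower.toTensorAlgebra : (⨂[k]^p V) →ₗ[k] TensorAlgebra k V) =
      tpow k V p := by
  apply le_antisymm
  · rw [LinearMap.range_eq_map, ← PiTensorProduct.span_tprod_eq_top, Submodule.map_span,
      Submodule.span_le]
    rintro _ ⟨_, ⟨x, rfl⟩, rfl⟩
    rw [TensorPower.toTensorAlgebra_tprod, TensorAlgebra.tprod_apply]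
    induction p with
    | zero => simp
    | succ n ih =>
      rw [List.ofFn_succ, List.prod_cons, tpow, pow_succ']
      exact Submodule.mul_mem_mul ⟨x 0, rfl⟩ (ih fun i => x i.succ)
  · induction p with
    | zero =>
      rw [tpow, pow_zero, Submodule.one_le]
      exact ⟨_, TensorPower.toTensorAlgebra_gOne⟩
    | succ n ih =>
      rw [tpow, pow_succ, Submodule.mul_le]
      rintro a ha _ ⟨v, rfl⟩
      obtain ⟨a, rfl⟩ := ih ha
      refine ⟨TensorPower.mulEquiv (a ⊗ₜ (PiTensorProduct.tprod k fun _ : Fin 1 => v)), ?_⟩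
      have := TensorPower.toTensorAlgebra_gMul (R := k) a
        (PiTensorProduct.tprod k fun _ : Fin 1 => v)
      rw [TensorPower.gMul_eq_coe_linearMap] at this
      refine this.trans ?_
      simp [TensorAlgebra.tprod_apply]

lemma toTensorAlgebra_injective (p : ℕ) :
    Function.Injective
      (TensorPower.toTensorAlgebra : (⨂[k]^p V) →ₗ[k] TensorAlgebra k V) := by
  have h : ∀ x : ⨂[k]^p V, TensorAlgebra.toDirectSum (TensorPower.toTensorAlgebra x) =
      DirectSum.of (fun n => ⨂[k]^n V) p x := by
    intro x
    rw [← TensorAlgebra.toDirectSum_ofDirectSum (DirectSum.of (fun n => ⨂[k]^n V) p x)]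
    congr 1
    exact (DirectSum.toAddMonoid_of
      (fun _ ↦ LinearMap.toAddMonoidHom TensorPower.toTensorAlgebra) p x).symm
  intro x y hxy
  apply DirectSum.of_injective (β := fun n => ⨂[k]^n V) p
  rw [← h, ← h, hxy]

lemma tpow_linearDisjoint (p q : ℕ) : (tpow k V p).LinearDisjoint (tpow k V q) := by
  rw [Submodule.linearDisjoint_iff]
  let e (n : ℕ) : (⨂[k]^n V) ≃ₗ[k] tpow k V n :=
    (LinearEquiv.ofInjective _ (toTensorAlgebra_injective k V n)).trans
      (LinearEquiv.ofEq _ _ (range_toTensorAlgebra k V n))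
  have he : ∀ n x, ((e n x : tpow k V n) : TensorAlgebra k V) =
    TensorPower.toTensorAlgebra x := fun n x => rfl
  have key : Submodule.mulMap (tpow k V p) (tpow k V q) ∘ₗ
      (TensorProduct.congr (e p) (e q)).toLinearMap =
      TensorPower.toTensorAlgebra ∘ₗ (TensorPower.mulEquiv (n := p) (m := q)).toLinearMap := by
    apply TensorProduct.ext'
    intro a b
    have := TensorPower.toTensorAlgebra_gMul (R := k) a b
    rw [TensorPower.gMul_eq_coe_linearMap] at this
    refine Eq.trans ?_ this.symm
    simp [he]
  have h2 : Function.Injective (Submodule.mulMap (tpow k V p) (tpow k V q) ∘ₗ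
      (TensorProduct.congr (e p) (e q)).toLinearMap) := by
    rw [key]
    exact (toTensorAlgebra_injective k V _).comp (LinearEquiv.injective _)
  intro x y hxy
  have := @h2 ((TensorProduct.congr (e p) (e q)).symm x)
    ((TensorProduct.congr (e p) (e q)).symm y) (by
      simpa only [LinearMap.comp_apply, LinearEquiv.coe_coe, LinearEquiv.apply_symm_apply]
        using hxy)
  simpa using this

end TensorAlgebraFacts

section Slices

variable {k : Type u} {T : Type v} [Field k] [Ring T] [Algebra k T]

/-- For linearly disjoint `E`, `F` and `U ≤ E`, a tensor in `E ⊗ F` comes from `U ⊗ F` iff all its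
slices by linear forms on `F` are in `U`. -/
lemma mem_mul_iff_left {E F U : Submodule k T} (h : E.LinearDisjoint F) (hU : U ≤ E)
    (t : E ⊗[k] F) :
    Submodule.mulMap E F t ∈ U * F ↔
      ∀ φ : F →ₗ[k] k, (TensorProduct.rid k E (φ.lTensor E t) : T) ∈ U := by
  rw [← Submodule.mulMap_range, ← Submodule.mulMap_comp_rTensor F hU]
  constructor
  · rintro ⟨s, hs⟩ φ
    have := h.injective hs
    subst this
    clear hs
    induction s with
    | zero => simp
    | tmul x y => simpa using U.smul_mem _ x.2
    | add x y hx hy => simpa using U.add_mem hx hy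
  · intro H
    classical
    let b := Module.Basis.ofVectorSpace k F
    have ht : t = ∑ i ∈ ((TensorProduct.equivFinsuppOfBasisRight b) t).support,
        (TensorProduct.equivFinsuppOfBasisRight b t i) ⊗ₜ b i := by
      have := (TensorProduct.equivFinsuppOfBasisRight (M := E) b).symm_apply_apply t
      conv_lhs => rw [← this]
      rw [TensorProduct.equivFinsuppOfBasisRight_symm_apply, Finsupp.sum]
    have hs : ∀ i, TensorProduct.equivFinsuppOfBasisRight b t i =
        TensorProduct.rid k E ((b.coord i).lTensor E t) := by
      intro i
      clear ht H
      induction t with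
      | zero => simp
      | tmul x y => simp
      | add x y hx hy => simp [hx, hy]
    rw [ht, map_sum]
    refine Submodule.sum_mem _ fun i _ => ⟨⟨_, H (b.coord i)⟩ ⊗ₜ b i, ?_⟩
    simp [hs]

lemma mem_mul_iff_right {E F U : Submodule k T} (h : E.LinearDisjoint F) (hU : U ≤ F)
    (t : E ⊗[k] F) :
    Submodule.mulMap E F t ∈ E * U ↔
      ∀ φ : E →ₗ[k] k, (TensorProduct.lid k F (φ.rTensor F t) : T) ∈ U := by
  rw [← Submodule.mulMap_range, ← Submodule.mulMap_comp_lTensor E hU]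
  constructor
  · rintro ⟨s, hs⟩ φ
    have := h.injective hs
    subst this
    clear hs
    induction s with
    | zero => simp
    | tmul x y => simpa using U.smul_mem _ y.2
    | add x y hx hy => simpa using U.add_mem hx hy
  · intro H
    classical
    let b := Module.Basis.ofVectorSpace k E
    have ht : t = ∑ i ∈ ((TensorProduct.equivFinsuppOfBasisLeft b) t).support,
        b i ⊗ₜ (TensorProduct.equivFinsuppOfBasisLeft b t i) := by
      have := (TensorProduct.equivFinsuppOfBasisLeft (N := F) b).symm_apply_apply t
      conv_lhs => rw [← this]
      rw [TensorProduct.equivFinsuppOfBasisLeft_symm_apply, Finsupp.sum]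
    have hs : ∀ i, TensorProduct.equivFinsuppOfBasisLeft b t i =
        TensorProduct.lid k F ((b.coord i).rTensor F t) := by
      intro i
      clear ht H
      induction t with
      | zero => simp
      | tmul x y => simp
      | add x y hx hy => simp [hx, hy]
    rw [ht, map_sum]
    refine Submodule.sum_mem _ fun i _ => ⟨b i ⊗ₜ ⟨_, H (b.coord i)⟩, ?_⟩
    simp [hs]

lemma mul_inf_mul_le {E F U U' : Submodule k T} (h : E.LinearDisjoint F) (hU : U ≤ E)
    (hU' : U' ≤ F) : (U * F) ⊓ (E * U') ≤ U * U' := by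
  rintro x ⟨h1, h2⟩
  rw [SetLike.mem_coe, ← Submodule.mulMap_range] at h1
  obtain ⟨s, rfl⟩ := h1
  have hd : U.LinearDisjoint F := h.of_le_left_of_flat hU
  rw [mem_mul_iff_right hd hU']
  intro φ
  obtain ⟨ψ, hψ⟩ : ∃ ψ : E →ₗ[k] k, ψ ∘ₗ Submodule.inclusion hU = φ :=
    LinearMap.exists_leftInverse_of_injective (Submodule.inclusion hU)
      (LinearMap.ker_eq_bot.2 (Submodule.inclusion_injective hU)) |>.elim fun g hg =>
        ⟨φ ∘ₗ g, by rw [LinearMap.comp_assoc, hg, LinearMap.comp_id]⟩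
  rw [SetLike.mem_coe, ← Submodule.mulMap_comp_rTensor F hU, LinearMap.comp_apply,
    mem_mul_iff_right h hU'] at h2
  have := h2 ψ
  rwa [← LinearMap.comp_apply, ← LinearMap.rTensor_comp, hψ] at this

end Slices

section Koszul

variable {k : Type u} {V : Type v} [Field k] [AddCommGroup V] [Module k V]

/-- The image in `T(V)` of a space of relations `R ⊆ V ⊗ V`. -/
def relSpace (R : Submodule k (V ⊗[k] V)) : Submodule k (TensorAlgebra k V) :=
  R.map (LinearMap.mul' k (TensorAlgebra k V) ∘ₗ
    TensorProduct.map (TensorAlgebra.ι k) (TensorAlgebra.ι k))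

lemma relSpace_le (R : Submodule k (V ⊗[k] V)) : relSpace R ≤ tpow k V 2 := by
  rintro _ ⟨t, -, rfl⟩
  induction t with
  | zero => simp
  | tmul x y =>
    rw [tpow, pow_two]
    simpa using Submodule.mul_mem_mul (LinearMap.mem_range_self (TensorAlgebra.ι k) x)
      (LinearMap.mem_range_self (TensorAlgebra.ι k) y)
  | add x y hx hy => simpa only [map_add] using Submodule.add_mem _ hx hy

/-- `W_p = ⋂_{i + 2 + j = p} V^{⊗i} ⊗ R ⊗ V^{⊗j}`, a subspace of `V^{⊗p}`.  The intersection is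
over the empty family for `p = 0, 1`, which gives `W_0 = k` and `W_1 = V`. -/
def W (R : Submodule k (V ⊗[k] V)) (p : ℕ) : Submodule k (TensorAlgebra k V) :=
  tpow k V p ⊓ ⨅ (i : ℕ) (j : ℕ) (_ : i + 2 + j = p), tpow k V i * relSpace R * tpow k V j

lemma mem_W {R : Submodule k (V ⊗[k] V)} {p : ℕ} {x : TensorAlgebra k V} :
    x ∈ W R p ↔ x ∈ tpow k V p ∧
      ∀ i j, i + 2 + j = p → x ∈ tpow k V i * relSpace R * tpow k V j := by
  simp [W, Submodule.mem_iInf]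

lemma W_le (R : Submodule k (V ⊗[k] V)) (p : ℕ) : W R p ≤ tpow k V p := inf_le_left

lemma W_zero (R : Submodule k (V ⊗[k] V)) : W R 0 = 1 := by
  ext x; rw [mem_W]; simp

lemma W_one (R : Submodule k (V ⊗[k] V)) : W R 1 = LinearMap.range (TensorAlgebra.ι k) := by
  ext x; rw [mem_W, tpow, pow_one]
  exact and_iff_left fun i j h => absurd h (by omega)

lemma W_two (R : Submodule k (V ⊗[k] V)) : W R 2 = relSpace R := by
  ext x; rw [mem_W]
  constructor
  · intro h; simpa using h.2 0 0 rfl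
  · refine fun h => ⟨relSpace_le R h, fun i j hij => ?_⟩
    obtain ⟨rfl, rfl⟩ : i = 0 ∧ j = 0 := by omega
    simpa using h

lemma W_linearDisjoint (R : Submodule k (V ⊗[k] V)) (p q : ℕ) :
    (W R p).LinearDisjoint (W R q) :=
  ((tpow_linearDisjoint k V p q).of_le_left_of_flat (W_le R p)).of_le_right_of_flat (W_le R q)

lemma W_le_mul (R : Submodule k (V ⊗[k] V)) {p q r : ℕ} (h : p + q = r) :
    W R r ≤ W R p * W R q := by
  subst h
  refine le_trans (le_inf ?_ ?_)
    (mul_inf_mul_le (tpow_linearDisjoint k V p q) (W_le R p) (W_le R q))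
  · intro x hx
    rw [mem_W] at hx
    have h1 := hx.1
    rw [tpow, pow_add, ← Submodule.mulMap_range] at h1
    obtain ⟨t, rfl⟩ := h1
    rw [mem_mul_iff_left (tpow_linearDisjoint k V p q) (W_le R p)]
    intro φ
    rw [mem_W]
    refine ⟨Subtype.prop _, fun i j hij => ?_⟩
    have hle : tpow k V i * relSpace R * tpow k V j ≤ tpow k V p := by
      rw [← hij, tpow, tpow, tpow, pow_add, pow_add]
      exact mul_le_mul' (mul_le_mul' le_rfl (relSpace_le R)) le_rfl
    refine (mem_mul_iff_left (tpow_linearDisjoint k V p q) hle t).1 ?_ φ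
    have := hx.2 i (j + q) (by omega)
    rwa [tpow, tpow, pow_add, ← mul_assoc] at this
  · intro x hx
    rw [mem_W] at hx
    have h1 := hx.1
    rw [tpow, pow_add, ← Submodule.mulMap_range] at h1
    obtain ⟨t, rfl⟩ := h1
    rw [mem_mul_iff_right (tpow_linearDisjoint k V p q) (W_le R q)]
    intro φ
    rw [mem_W]
    refine ⟨Subtype.prop _, fun i j hij => ?_⟩
    have hle : tpow k V i * relSpace R * tpow k V j ≤ tpow k V q := by
      rw [← hij, tpow, tpow, tpow, pow_add, pow_add]
      exact mul_le_mul' (mul_le_mul' le_rfl (relSpace_le R)) le_rfl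
    refine (mem_mul_iff_right (tpow_linearDisjoint k V p q) hle t).1 ?_ φ
    have := hx.2 (p + i) j (by omega)
    rwa [tpow, tpow, pow_add, mul_assoc, mul_assoc, ← mul_assoc (_ ^ i)] at this

/-- The inclusion `W_{p+q} ⊆ W_p ⊗ W_q`: the element `x_1 … x_{p+q}` of `W_{p+q}` viewed as
`x_1 … x_p ⊗ x_{p+1} … x_{p+q}`.  It is the unique map whose composition with the
(injective) multiplication `W_p ⊗ W_q → T(V)` is the inclusion of `W_{p+q}`. -/
def split (R : Submodule k (V ⊗[k] V)) {p q r : ℕ} (h : p + q = r) :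
    W R r →ₗ[k] W R p ⊗[k] W R q :=
  (LinearEquiv.ofInjective (Submodule.mulMap (W R p) (W R q))
    (W_linearDisjoint R p q).injective).symm.toLinearMap ∘ₗ
      Submodule.inclusion ((W_le_mul R h).trans (Submodule.mulMap_range _ _).ge)

@[simp]
lemma mulMap_split (R : Submodule k (V ⊗[k] V)) {p q r : ℕ} (h : p + q = r) (x : W R r) :
    Submodule.mulMap (W R p) (W R q) (split R h x) = x :=
  congrArg Subtype.val (LinearEquiv.apply_symm_apply (LinearEquiv.ofInjective
    (Submodule.mulMap (W R p) (W R q)) (W_linearDisjoint R p q).injective) _)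

lemma split_coassoc (R : Submodule k (V ⊗[k] V)) {p q r a b n : ℕ} (h1 : p + q = a)
    (h2 : a + r = n) (h3 : q + r = b) (h4 : p + b = n) (x : W R n) :
    TensorProduct.assoc k _ _ _ ((split R h1).rTensor (W R r) (split R h2 x)) =
      (split R h3).lTensor (W R p) (split R h4 x) := by
  let m : W R p ⊗[k] (W R q ⊗[k] W R r) →ₗ[k] TensorAlgebra k V :=
    LinearMap.mul' k _ ∘ₗ TensorProduct.map (W R p).subtype (Submodule.mulMap (W R q) (W R r))
  have hm : Function.Injective m := by
    have hq : ∀ t, Submodule.mulMap (W R q) (W R r) t ∈ tpow k V b := by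
      intro t
      rw [← h3, tpow, pow_add]
      refine mul_le_mul' (W_le R q) (W_le R r) ?_
      rw [← Submodule.mulMap_range]
      exact ⟨t, rfl⟩
    have : m = Submodule.mulMap (W R p) (tpow k V b) ∘ₗ
        ((Submodule.mulMap (W R q) (W R r)).codRestrict (tpow k V b) hq).lTensor (W R p) := by
      ext; rfl
    rw [this]
    refine (((tpow_linearDisjoint k V p b).of_le_left_of_flat (W_le R p)).injective).comp ?_
    apply Module.Flat.lTensor_preserves_injective_linearMap
    intro s t hst
    exact (W_linearDisjoint R q r).injective (congrArg Subtype.val hst)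
  apply hm
  trans (x : TensorAlgebra k V)
  · rw [← mulMap_split R h2 x]
    generalize split R h2 x = t
    induction t with
    | zero => simp
    | add x y hx hy => simp only [map_add, hx, hy]
    | tmul y z =>
      simp only [LinearMap.rTensor_tmul, Submodule.mulMap_tmul]
      rw [← mulMap_split R h1 y]
      generalize split R h1 y = t
      induction t with
      | zero => simp
      | add x y hx hy => simp only [map_add, hx, hy, TensorProduct.add_tmul, add_mul]
      | tmul a b => simp [m, mul_assoc]
  · rw [← mulMap_split R h4 x]
    generalize split R h4 x = t
    induction t with
    | zero => simp
    | add x y hx hy => simp only [map_add, hx, hy]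
    | tmul y z => simp [m]

end Koszul

/-- A presentation of a `k`-algebra `A` as a quadratic algebra `T(V)/(R)`, with `R ⊆ V ⊗ V`. -/
structure QuadraticPresentation (k : Type u) (V : Type v) (A : Type w) [Field k] [AddCommGroup V]
    [Module k V] [Ring A] [Algebra k A] where
  /-- The space of relations. -/
  R : Submodule k (V ⊗[k] V)
  /-- The projection `T(V) → A`. -/
  proj : TensorAlgebra k V →ₐ[k] A
  surjective : Function.Surjective proj
  proj_eq_zero_iff : ∀ t, proj t = 0 ↔ t ∈ TwoSidedIdeal.span (relSpace R : Set (TensorAlgebra k V))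

namespace QuadraticPresentation

variable {k : Type u} {V : Type v} {A : Type w} [Field k] [AddCommGroup V] [Module k V] [Ring A]
  [Algebra k A] (P : QuadraticPresentation k V A)

/-- The space of Koszul `p`-cochains with coefficients in `A`. -/
abbrev Cochain (p : ℕ) := W P.R p →ₗ[k] A

/-- `x_1 … x_{p+q} ↦ f(x_1 … x_p) g(x_{p+1} … x_{p+q})`. -/
def concat {p q r : ℕ} (h : p + q = r) (f : P.Cochain p) (g : P.Cochain q) : P.Cochain r :=
  LinearMap.mul' k A ∘ₗ TensorProduct.map f g ∘ₗ split P.R h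

lemma concat_apply_of_eq {p q r : ℕ} (h : p + q = r) (f : P.Cochain p) (g : P.Cochain q)
    (z : W P.R r) (t : W P.R p ⊗[k] W P.R q)
    (ht : Submodule.mulMap (W P.R p) (W P.R q) t = z) :
    P.concat h f g z = LinearMap.mul' k A (TensorProduct.map f g t) := by
  have : split P.R h z = t :=
    (W_linearDisjoint P.R p q).injective ((mulMap_split P.R h z).trans ht.symm)
  simp [concat, this]

/-- The Koszul cup product of Koszul cochains:
`(f ⌣ g)(x_1 … x_{p+q}) = (-1)^{pq} f(x_1 … x_p) g(x_{p+1} … x_{p+q})`. -/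
def cup {p q r : ℕ} (h : p + q = r) (f : P.Cochain p) (g : P.Cochain q) : P.Cochain r :=
  (-1 : k) ^ (p * q) • P.concat h f g

/-- The fundamental 1-cocycle `e_A : V → A`, `e_A(x) = x`. -/
def fundamental : P.Cochain 1 := P.proj.toLinearMap ∘ₗ (W P.R 1).subtype

/-- The Koszul differential
`b_K(f)(x_1 … x_{p+1}) = f(x_1 … x_p) x_{p+1} - (-1)^p x_1 f(x_2 … x_{p+1})`. -/
def bK (p : ℕ) : P.Cochain p →ₗ[k] P.Cochain (p + 1) where
  toFun f := P.concat rfl f P.fundamental -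
    (-1 : k) ^ p • P.concat (Nat.add_comm 1 p) P.fundamental f
  map_add' f g := by
    simp only [concat, TensorProduct.map_add_left, TensorProduct.map_add_right,
      LinearMap.add_comp, LinearMap.comp_add, smul_add]
    abel
  map_smul' c f := by
    simp only [concat, TensorProduct.map_smul_left, TensorProduct.map_smul_right,
      LinearMap.smul_comp, LinearMap.comp_smul, RingHom.id_apply, smul_sub]
    rw [smul_comm c]

/-- The map `e_A ⌣ -` on Koszul cochains. -/
def cupE (p : ℕ) : P.Cochain p →ₗ[k] P.Cochain (p + 1) where
  toFun f := P.cup (Nat.add_comm 1 p) P.fundamental f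
  map_add' f g := by
    simp only [cup, concat, TensorProduct.map_add_right,
      LinearMap.add_comp, LinearMap.comp_add, smul_add]
  map_smul' c f := by
    simp only [cup, concat, TensorProduct.map_smul_right,
      LinearMap.smul_comp, LinearMap.comp_smul, RingHom.id_apply]
    rw [smul_comm c]

lemma concat_assoc {p q r a b n : ℕ} (h1 : p + q = a) (h2 : a + r = n) (h3 : q + r = b)
    (h4 : p + b = n) (f : P.Cochain p) (g : P.Cochain q) (l : P.Cochain r) :
    P.concat h2 (P.concat h1 f g) l = P.concat h4 f (P.concat h3 g l) := by
  ext x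
  have key := split_coassoc P.R h1 h2 h3 h4 x
  have e1 : ∀ t : W P.R a ⊗[k] W P.R r,
      LinearMap.mul' k A (TensorProduct.map (P.concat h1 f g) l t) =
      (LinearMap.mul' k A ∘ₗ TensorProduct.map f (LinearMap.mul' k A ∘ₗ TensorProduct.map g l))
        (TensorProduct.assoc k _ _ _ ((split P.R h1).rTensor (W P.R r) t)) := by
    intro t
    induction t with
    | zero => simp
    | add x y hx hy => simp only [map_add, hx, hy]
    | tmul y z =>
      simp only [concat, TensorProduct.map_tmul, LinearMap.comp_apply, LinearMap.rTensor_tmul]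
      generalize split P.R h1 y = t
      induction t with
      | zero => simp
      | add x y hx hy => simp only [map_add, hx, hy, TensorProduct.add_tmul]
      | tmul a b => simp [mul_assoc]
  have e2 : ∀ t : W P.R p ⊗[k] W P.R b,
      LinearMap.mul' k A (TensorProduct.map f (P.concat h3 g l) t) =
      (LinearMap.mul' k A ∘ₗ TensorProduct.map f (LinearMap.mul' k A ∘ₗ TensorProduct.map g l))
        ((split P.R h3).lTensor (W P.R p) t) := by
    intro t
    induction t with
    | zero => simp
    | add x y hx hy => simp only [map_add, hx, hy]
    | tmul y z => simp [concat]
  change LinearMap.mul' k A (TensorProduct.map (P.concat h1 f g) l (split P.R h2 x)) =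
    LinearMap.mul' k A (TensorProduct.map f (P.concat h3 g l) (split P.R h4 x))
  rw [e1, e2, key]

lemma concat_fundamental_fundamental :
    P.concat (rfl : 1 + 1 = 2) P.fundamental P.fundamental = 0 := by
  ext x
  have e1 : ∀ t : W P.R 1 ⊗[k] W P.R 1,
      LinearMap.mul' k A (TensorProduct.map P.fundamental P.fundamental t) =
      P.proj (Submodule.mulMap _ _ t) := by
    intro t
    induction t with
    | zero => simp
    | add x y hx hy => simp only [map_add, hx, hy]
    | tmul y z => simp [fundamental]
  change LinearMap.mul' k A (TensorProduct.map P.fundamental P.fundamental (split P.R rfl x)) = 0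
  rw [e1, mulMap_split, P.proj_eq_zero_iff]
  exact TwoSidedIdeal.subset_span ((W_two P.R).le x.2)

lemma concat_zero_left {p q r : ℕ} (h : p + q = r) (g : P.Cochain q) :
    P.concat h 0 g = 0 := by simp [concat]

lemma concat_zero_right {p q r : ℕ} (h : p + q = r) (f : P.Cochain p) :
    P.concat h f 0 = 0 := by simp [concat]

lemma concat_sub_left {p q r : ℕ} (h : p + q = r) (f f' : P.Cochain p) (g : P.Cochain q) :
    P.concat h (f - f') g = P.concat h f g - P.concat h f' g := by
  rw [eq_sub_iff_add_eq]
  simp only [concat, ← LinearMap.comp_add, ← LinearMap.add_comp, ← TensorProduct.map_add_left,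
    sub_add_cancel]

lemma concat_smul_left {p q r : ℕ} (h : p + q = r) (c : k) (f : P.Cochain p) (g : P.Cochain q) :
    P.concat h (c • f) g = c • P.concat h f g := by
  simp [concat, TensorProduct.map_smul_left, LinearMap.smul_comp, LinearMap.comp_smul]

lemma concat_sub_right {p q r : ℕ} (h : p + q = r) (f : P.Cochain p) (g g' : P.Cochain q) :
    P.concat h f (g - g') = P.concat h f g - P.concat h f g' := by
  rw [eq_sub_iff_add_eq]
  simp only [concat, ← LinearMap.comp_add, ← LinearMap.add_comp, ← TensorProduct.map_add_right,
    sub_add_cancel]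

lemma concat_smul_right {p q r : ℕ} (h : p + q = r) (c : k) (f : P.Cochain p) (g : P.Cochain q) :
    P.concat h f (c • g) = c • P.concat h f g := by
  simp [concat, TensorProduct.map_smul_right, LinearMap.smul_comp, LinearMap.comp_smul]

lemma concat_left_left {p : ℕ} (f : P.Cochain p) :
    P.concat (Nat.add_comm 1 (p + 1)) P.fundamental
      (P.concat (Nat.add_comm 1 p) P.fundamental f) = 0 := by
  rw [← P.concat_assoc (rfl : 1 + 1 = 2) (Nat.add_comm 2 p), concat_fundamental_fundamental,
    concat_zero_left]

lemma concat_right_right {p : ℕ} (f : P.Cochain p) :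
    P.concat (rfl : p + 1 + 1 = p + 1 + 1) (P.concat rfl f P.fundamental) P.fundamental = 0 := by
  rw [P.concat_assoc rfl rfl (rfl : 1 + 1 = 2) rfl, concat_fundamental_fundamental,
    concat_zero_right]

lemma bK_bK (p : ℕ) (f : P.Cochain p) : P.bK (p + 1) (P.bK p f) = 0 := by
  simp only [bK, LinearMap.coe_mk, AddHom.coe_mk, concat_sub_left, concat_sub_right,
    concat_smul_left, concat_smul_right, concat_left_left, concat_right_right]
  rw [P.concat_assoc (Nat.add_comm 1 p) rfl rfl (Nat.add_comm 1 (p + 1)), pow_succ]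
  ext x
  simp

lemma cupE_cupE (p : ℕ) (f : P.Cochain p) : P.cupE (p + 1) (P.cupE p f) = 0 := by
  simp only [cupE, cup, LinearMap.coe_mk, AddHom.coe_mk, concat_smul_right, concat_left_left,
    smul_zero]

lemma bK_cupE (p : ℕ) (f : P.Cochain p) :
    P.bK (p + 1) (P.cupE p f) = - P.cupE (p + 1) (P.bK p f) := by
  simp only [bK, cupE, cup, LinearMap.coe_mk, AddHom.coe_mk, concat_sub_right,
    concat_smul_left, concat_smul_right, concat_left_left, one_mul]
  rw [P.concat_assoc (Nat.add_comm 1 p) rfl rfl (Nat.add_comm 1 (p + 1)), pow_succ]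
  ext x
  simp

end QuadraticPresentation

section Cohomology

variable {k : Type u} [Field k] {C : ℕ → Type v} [∀ p, AddCommGroup (C p)] [∀ p, Module k (C p)]
  (d : ∀ p, C p →ₗ[k] C (p + 1))

/-- The boundaries in degree `p` of a sequence `C 0 → C 1 → C 2 → ⋯`. -/
def boundaries : ∀ p, Submodule k (C p)
  | 0 => ⊥
  | p + 1 => LinearMap.range (d p)

/-- The cohomology `ker (d_p) / im (d_{p-1})` of a cochain complex `C 0 → C 1 → C 2 → ⋯`. -/
abbrev Cohomology (p : ℕ) : Type v :=
  LinearMap.ker (d p) ⧸ (boundaries d p).submoduleOf (LinearMap.ker (d p))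

end Cohomology

namespace QuadraticPresentation

variable {k : Type u} {V : Type v} {A : Type w} [Field k] [AddCommGroup V] [Module k V] [Ring A]
  [Algebra k A] (P : QuadraticPresentation k V A)

/-- The Koszul cohomology `HK^p(A)`. -/
abbrev HK (p : ℕ) := Cohomology P.bK p

/-- `e_A ⌣ -` on Koszul cocycles. -/
def cupEKer (p : ℕ) : LinearMap.ker (P.bK p) →ₗ[k] LinearMap.ker (P.bK (p + 1)) :=
  (P.cupE p).restrict fun f hf => by
    rw [LinearMap.mem_ker] at hf ⊢
    rw [bK_cupE, hf, map_zero, neg_zero]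

/-- The map `∂_⌣ : HK^p(A) → HK^{p+1}(A)`, the cup product with the class of `e_A`:
it sends the class of a cocycle `f` to the class of `e_A ⌣ f`. -/
def cupDiff (p : ℕ) : P.HK p →ₗ[k] P.HK (p + 1) :=
  Submodule.mapQ _ _ (P.cupEKer p) <| by
    rintro ⟨f, hf⟩ hfb
    cases p with
    | zero =>
      obtain rfl : f = 0 := hfb
      exact ⟨0, by simp [cupEKer]⟩
    | succ p =>
      obtain ⟨g, rfl⟩ : ∃ g, P.bK p g = f := hfb
      exact ⟨-P.cupE p g, by simp [cupEKer, bK_cupE]⟩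

lemma cupDiff_cupDiff (p : ℕ) (α : P.HK p) : P.cupDiff (p + 1) (P.cupDiff p α) = 0 := by
  obtain ⟨f, rfl⟩ := Submodule.Quotient.mk_surjective _ α
  have : P.cupEKer (p + 1) (P.cupEKer p f) = 0 := Subtype.ext (P.cupE_cupE p f)
  simp [cupDiff, this]

/-- The higher Koszul cohomology `HK_hi^p(A)`: the cohomology of `HK^•(A)` with respect to the
differential `∂_⌣`. -/
abbrev HKhi (p : ℕ) := Cohomology P.cupDiff p

end QuadraticPresentation

section Symmetric

variable (k : Type u) (V : Type v) [Field k] [AddCommGroup V] [Module k V]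

/-- The symmetric algebra `S(V)` as the quadratic algebra `T(V)/(R)`, where `R` is spanned by the
`x ⊗ y - y ⊗ x` for `x`, `y` in `V`. -/
def symmetricPresentation : QuadraticPresentation k V (SymmetricAlgebra k V) where
  R := Submodule.span k {t | ∃ x y : V, t = x ⊗ₜ[k] y - y ⊗ₜ[k] x}
  proj := SymmetricAlgebra.algHom k V
  surjective := SymmetricAlgebra.algHom_surjective k V
  proj_eq_zero_iff t := by
    set R : Submodule k (V ⊗[k] V) :=
      Submodule.span k {t | ∃ x y : V, t = x ⊗ₜ[k] y - y ⊗ₜ[k] x} with hR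
    constructor
    · intro h
      have h1 : TensorAlgebra.symRingCon k V t 0 := by
        rw [← RingCon.eq]
        exact h
      have h2 : TensorAlgebra.symRingCon k V ≤
          (TwoSidedIdeal.span (relSpace R : Set (TensorAlgebra k V))).ringCon := by
        refine RingCon.ringConGen_le.2 ?_
        rintro _ _ ⟨x, y⟩
        rw [TwoSidedIdeal.rel_iff]
        refine TwoSidedIdeal.subset_span ⟨x ⊗ₜ y - y ⊗ₜ x, Submodule.subset_span ⟨x, y, rfl⟩, ?_⟩
        simp
      simpa using (TwoSidedIdeal.rel_iff _ _ _).1 (h2 h1)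
    · intro h
      rw [← TwoSidedIdeal.mem_ker]
      refine TwoSidedIdeal.span_le.2 ?_ h
      rintro _ ⟨r, hr, rfl⟩
      rw [SetLike.mem_coe, TwoSidedIdeal.mem_ker]
      induction hr using Submodule.span_induction with
      | mem r hr =>
        obtain ⟨x, y, rfl⟩ := hr
        have : SymmetricAlgebra.ι k V x * SymmetricAlgebra.ι k V y =
          SymmetricAlgebra.ι k V y * SymmetricAlgebra.ι k V x := mul_comm _ _
        simp only [LinearMap.comp_apply, map_sub, TensorProduct.map_tmul, LinearMap.mul'_apply,
          map_mul, sub_eq_zero]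
        exact this
      | zero => simp
      | add a b _ _ ha hb => simp only [map_add, ha, hb, add_zero]
      | smul c a _ ha => rw [map_smul, map_smul, ha, smul_zero]

end Symmetric

end KoszulCalculus

end

/-! For `S(V)` the space `W_p` is a copy of the exterior power `Λ^p V` inside `V^{⊗p}`. It carries
two operators, contraction `ι_φ` of the first factor and signed shuffle `v ∧ -`, linked by `ι_φ (v ∧
t) + v ∧ ι_φ t = φ(v) t` (`contract_shuffle`). No factorials occur, so the characteristic plays no
role.

Moving the first vector of an element of `W_{p+1}` to the end costs `(-1)^p` (`sum_contract_mul_ι`).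
As `S(V)` is commutative, this gives `b_K = 0` (`bK_eq_zero`), hence `HK^p = Hom(W_p, S(V))`. For a
basis with coordinate contractions `ι_i`, the map `e_A ⌣ -` is, up to sign, `f ↦ (w ↦ ∑ x_i f(ι_i
w))` (`cupE_apply`). This is the Koszul complex of the variables of a polynomial ring, whose
cohomology is `k`, in top degree only.

That fact is proved by eliminating one variable at a time. Given a cocycle `f`, evaluating the
cocycle equation at `b_m ∧ w` and dividing by `x_m` shows that `f` is cohomologous to `w ↦ f(b_m ∧
ι_m w)|_{x_m = 0}` (`sub_reduce_mem_boundaries`). After all variables are treated, only the part of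
`w` divisible by every `b_m` matters, together with constant terms of values. So every cocycle
outside degree `n` is a boundary, and in degree `n` the class of `f` is measured by the constant
term of `f(b_1 ∧ ⋯ ∧ b_n)` (`residue_eq_zero_iff`), which is nonzero for some cocycle
(`exists_cocycle_residue_ne_zero`). -/

noncomputable section

namespace KoszulCalculus

universe u v

/-! ### Contraction and signed shuffle on the tensor algebra and on `W_p`. -/

section Operators

variable {k : Type u} {V : Type v} [Field k] [AddCommGroup V] [Module k V]

local notation "T" => TensorAlgebra k V
local notation "τ" => TensorAlgebra.ι k (M := V)

/-- The linear endomorphism `F` of `T(V)` with `F 1 = c` and `F (u t) = B u (t, F t)`. -/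
def tensorRec (B : V →ₗ[k] T × T →ₗ[k] T) (c : T) : T →ₗ[k] T :=
  LinearMap.snd k T T ∘ₗ LinearMap.applyₗ ((1, c) : T × T) ∘ₗ
    (TensorAlgebra.lift k (A := Module.End k (T × T))
      -- The value `F (u t)` may depend on `t` as well as on `F t`, so the action of `T(V)` is on
      -- pairs `(t, F t)`, started at `(1, c)`.
      { toFun := fun u => (LinearMap.mulLeft k (τ u) ∘ₗ LinearMap.fst k T T).prod (B u)
        map_add' := fun x y => by ext <;> simp [add_mul]
        map_smul' := fun a x => by ext <;> simp }).toLinearMap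

lemma tensorRec_one (B : V →ₗ[k] T × T →ₗ[k] T) (c : T) : tensorRec B c 1 = c := by
  simp [tensorRec]

lemma tensorRec_ι_mul (B : V →ₗ[k] T × T →ₗ[k] T) (c : T) (u : V) (t : T) :
    tensorRec B c (τ u * t) = B u (t, tensorRec B c t) := by
  have h : ∀ t : T, (TensorAlgebra.lift k (A := Module.End k (T × T))
      { toFun := fun u => (LinearMap.mulLeft k (τ u) ∘ₗ LinearMap.fst k T T).prod (B u)
        map_add' := fun x y => by ext <;> simp [add_mul]
        map_smul' := fun a x => by ext <;> simp } t (1, c)).1 = t := by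
    intro t
    have h' : ∀ s : T × T, (TensorAlgebra.lift k (A := Module.End k (T × T))
      { toFun := fun u => (LinearMap.mulLeft k (τ u) ∘ₗ LinearMap.fst k T T).prod (B u)
        map_add' := fun x y => by ext <;> simp [add_mul]
        map_smul' := fun a x => by ext <;> simp } t s).1 = t * s.1 := by
      induction t using TensorAlgebra.induction with
      | algebraMap r => intro s; simp [Module.algebraMap_end_apply, Algebra.smul_def]
      | ι x => intro s; simp
      | mul x y hx hy => intro s; simp [hx, hy, mul_assoc]
      | add x y hx hy => intro s; simp [hx, hy, add_mul]
    simpa using h' (1, c)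
  simp only [tensorRec, LinearMap.comp_apply, AlgHom.toLinearMap_apply, map_mul,
    LinearMap.applyₗ_apply_apply, Module.End.mul_apply, TensorAlgebra.lift_ι_apply,
    LinearMap.coe_mk, AddHom.coe_mk, LinearMap.snd_apply, LinearMap.prod_apply]
  exact congrArg (B u) (Prod.ext (h t) rfl)

/-- Contraction of the first factor of a tensor with a linear form. -/
def contract (φ : V →ₗ[k] k) : T →ₗ[k] T :=
  tensorRec (LinearMap.lcomp k T (LinearMap.fst k T T) ∘ₗ LinearMap.lsmul k T ∘ₗ φ) 0

/-- The signed shuffle product with the vector `v`. -/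
def shuffle (v : V) : T →ₗ[k] T :=
  tensorRec ((LinearMap.lcomp k T (LinearMap.fst k T T) ∘ₗ
      LinearMap.llcomp k T T T (LinearMap.mulLeft k (τ v)) -
        LinearMap.lcomp k T (LinearMap.snd k T T)) ∘ₗ LinearMap.mul k T ∘ₗ τ) (τ v)

@[simp] lemma contract_one (φ : V →ₗ[k] k) : contract φ (1 : T) = 0 := tensorRec_one _ _

@[simp] lemma contract_ι_mul (φ : V →ₗ[k] k) (u : V) (t : T) :
    contract φ (τ u * t) = φ u • t := by
  simp [contract, tensorRec_ι_mul]

@[simp] lemma contract_ι (φ : V →ₗ[k] k) (u : V) :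
    contract φ (τ u) = algebraMap k T (φ u) := by
  simpa [Algebra.algebraMap_eq_smul_one] using contract_ι_mul φ u 1

@[simp] lemma shuffle_one (v : V) : shuffle v (1 : T) = τ v := tensorRec_one _ _

@[simp] lemma shuffle_ι_mul (v u : V) (t : T) :
    shuffle v (τ u * t) = τ v * (τ u * t) - τ u * shuffle v t := by
  simp [shuffle, tensorRec_ι_mul]

-- This is the induction scheme matching `tensorRec`. Stability under left multiplication by vectors
-- gives stability under left multiplication by any tensor, which is then applied to `1`.
@[elab_as_elim]
lemma tensor_induction {motive : T → Prop} (one : motive 1)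
    (ι_mul : ∀ u t, motive t → motive (τ u * t))
    (add : ∀ s t, motive s → motive t → motive (s + t))
    (smul : ∀ (c : k) t, motive t → motive (c • t)) (t : T) : motive t := by
  have h : ∀ s, motive s → motive (t * s) := by
    induction t using TensorAlgebra.induction with
    | algebraMap r => intro s hs; rw [← Algebra.smul_def]; exact smul r s hs
    | ι x => exact ι_mul x
    | mul x y hx hy => intro s hs; rw [mul_assoc]; exact hx _ (hy _ hs)
    | add x y hx hy => intro s hs; rw [add_mul]; exact add _ _ (hx _ hs) (hy _ hs)
  simpa using h 1 one

/-- The Clifford relation between interior and exterior multiplication. It already holds on all of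
`T(V)`, straight from the two recursions. -/
lemma contract_shuffle (φ : V →ₗ[k] k) (v : V) (t : T) :
    contract φ (shuffle v t) = φ v • t - shuffle v (contract φ t) := by
  induction t using tensor_induction with
  | one => simp [Algebra.algebraMap_eq_smul_one]
  | ι_mul u t _ => simp
  | add s t hs ht => simp only [map_add, hs, ht, smul_add]; abel
  | smul c t ht => simp only [map_smul, ht, smul_sub, smul_comm c]

@[elab_as_elim]
lemma tpow_succ_induction {p : ℕ} {motive : T → Prop}
    (ι_mul : ∀ u, ∀ t ∈ tpow k V p, motive (τ u * t))
    (add : ∀ s t, motive s → motive t → motive (s + t)) {t : T}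
    (ht : t ∈ tpow k V (p + 1)) : motive t := by
  rw [tpow, pow_succ'] at ht
  refine Submodule.mul_induction_on ht ?_ add
  rintro _ ⟨u, rfl⟩ t ht
  exact ι_mul u t ht

@[elab_as_elim]
lemma W_succ_induction {R : Submodule k (V ⊗[k] V)} {p : ℕ} {motive : T → Prop}
    (ι_mul : ∀ u, ∀ t ∈ W R p, motive (τ u * t))
    (add : ∀ s t, motive s → motive t → motive (s + t)) {t : T}
    (ht : t ∈ W R (p + 1)) : motive t := by
  have ht := W_le_mul R (add_comm 1 p) ht
  rw [W_one] at ht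
  refine Submodule.mul_induction_on ht ?_ add
  rintro _ ⟨u, rfl⟩ t ht
  exact ι_mul u t ht

lemma sum_ι_mul_contract {I : Type*} [Fintype I] (b : Module.Basis I k V) {p : ℕ} {t : T}
    (ht : t ∈ tpow k V (p + 1)) : ∑ i, τ (b i) * contract (b.coord i) t = t := by
  refine tpow_succ_induction (fun u t _ => ?_) (fun s t hs ht => ?_) ht
  ·
    simp only [contract_ι_mul, mul_smul_comm, ← smul_mul_assoc, ← Finset.sum_mul, ← map_smul,
      ← map_sum]
    simp [b.sum_repr]
  · simp only [map_add, mul_add, Finset.sum_add_distrib, hs, ht]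

/-- Since `W_{p+1} ⊆ V ⊗ W_p`, removing the first factor leaves an element of `W_p`. -/
lemma contract_mem_W (R : Submodule k (V ⊗[k] V)) (φ : V →ₗ[k] k) {p : ℕ} {t : T}
    (ht : t ∈ W R (p + 1)) : contract φ t ∈ W R p := by
  refine W_succ_induction (fun u t ht => ?_) (fun s t hs ht => ?_) ht
  · simpa using Submodule.smul_mem _ _ ht
  · simpa using add_mem hs ht

lemma contract_W_zero (R : Submodule k (V ⊗[k] V)) (φ : V →ₗ[k] k) {t : T}
    (ht : t ∈ W R 0) : contract φ t = 0 := by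
  rw [W_zero, Submodule.mem_one] at ht
  obtain ⟨c, rfl⟩ := ht
  simp [Algebra.algebraMap_eq_smul_one]

lemma ι_mul_mem_mul {U : Submodule k T} (v : V) {t : T} (ht : t ∈ U) :
    τ v * t ∈ LinearMap.range τ * U :=
  Submodule.mul_mem_mul ⟨v, rfl⟩ ht

lemma shuffle_mem_tpow (v : V) {p : ℕ} {t : T} (ht : t ∈ tpow k V p) :
    shuffle v t ∈ tpow k V (p + 1) := by
  induction p generalizing t with
  | zero =>
    rw [tpow, pow_zero, Submodule.mem_one] at ht
    obtain ⟨c, rfl⟩ := ht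
    simpa [tpow, Algebra.algebraMap_eq_smul_one] using
      Submodule.smul_mem _ c (LinearMap.mem_range_self τ v)
  | succ p ih =>
    refine tpow_succ_induction (fun u t ht => ?_) (fun s t hs ht => ?_) ht
    ·
      rw [shuffle_ι_mul, tpow, pow_succ']
      refine sub_mem (ι_mul_mem_mul v ?_) (ι_mul_mem_mul u (ih ht))
      rw [pow_succ']
      exact ι_mul_mem_mul u ht
    · simpa using add_mem hs ht

/-- The conditions defining `W_{p+2}` with `i ≥ 1` all follow from membership in `V ⊗ W_{p+1}`; only
the one with the relation in front (`i = 0`) is separate. -/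
lemma mem_W_succ_succ {R : Submodule k (V ⊗[k] V)} {p : ℕ} {t : T}
    (h1 : t ∈ LinearMap.range τ * W R (p + 1)) (h2 : t ∈ relSpace R * tpow k V p) :
    t ∈ W R (p + 2) := by
  rw [mem_W]
  constructor
  · have h : LinearMap.range τ * W R (p + 1) ≤ tpow k V (p + 2) := by
      rw [tpow, pow_succ']
      exact mul_le_mul' le_rfl (W_le R _)
    exact h h1
  · rintro (_ | i) j hij
    · obtain rfl : j = p := by omega
      simpa using h2
    · have h : LinearMap.range τ * W R (p + 1) ≤
          tpow k V (i + 1) * relSpace R * tpow k V j := by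
        rw [tpow, pow_succ', mul_assoc, mul_assoc, ← mul_assoc (_ ^ i)]
        exact mul_le_mul' le_rfl fun x hx => (mem_W.1 hx).2 i j (by omega)
      exact h h1

/-- The relations `x ⊗ y - y ⊗ x` of the symmetric algebra. -/
abbrev symRel (k : Type u) (V : Type v) [Field k] [AddCommGroup V] [Module k V] :
    Submodule k (V ⊗[k] V) := (symmetricPresentation k V).R

lemma commutator_mem (x y : V) : τ x * τ y - τ y * τ x ∈ relSpace (symRel k V) :=
  ⟨x ⊗ₜ y - y ⊗ₜ x, Submodule.subset_span ⟨x, y, rfl⟩, by simp⟩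

@[elab_as_elim]
lemma relSpace_mul_induction {U : Submodule k T} {motive : T → Prop}
    (commutator : ∀ x y, ∀ t ∈ U, motive ((τ x * τ y - τ y * τ x) * t))
    (add : ∀ s t, motive s → motive t → motive (s + t)) {t : T}
    (ht : t ∈ relSpace (symRel k V) * U) : motive t := by
  have h0 : motive 0 := by simpa using commutator 0 0 0 U.zero_mem
  refine Submodule.mul_induction_on ht ?_ add
  rintro _ ⟨r, hr', rfl⟩
  have hr : r ∈ Submodule.span k {t | ∃ x y : V, t = x ⊗ₜ[k] y - y ⊗ₜ[k] x} := hr'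
  clear hr'
  induction hr using Submodule.span_induction with
  | mem r hr => obtain ⟨x, y, rfl⟩ := hr; intro t ht; simpa using commutator x y t ht
  | zero => intro t ht; simpa using h0
  | add a b _ _ ha hb =>
    intro t ht
    rw [map_add, add_mul]
    exact add _ _ (ha t ht) (hb t ht)
  | smul c a _ ha =>
    intro t ht
    rw [map_smul, smul_mul_assoc, ← mul_smul_comm]
    exact ha _ (U.smul_mem c ht)

lemma W_le_relSpace_mul (R : Submodule k (V ⊗[k] V)) (p : ℕ) :
    W R (p + 2) ≤ relSpace R * tpow k V p := fun t ht => by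
  simpa using (mem_W.1 ht).2 0 p (by omega)

lemma shuffle_mem_relSpace_mul (v : V) {p : ℕ} {t : T}
    (ht : t ∈ relSpace (symRel k V) * tpow k V p) :
    shuffle v t ∈ relSpace (symRel k V) * tpow k V (p + 1) := by
  refine relSpace_mul_induction (fun x y t ht => ?_) (fun s t hs ht => ?_) ht
  ·
    have hι : ∀ u : V, τ u * t ∈ tpow k V (p + 1) := fun u => by
      rw [tpow, pow_succ']
      exact ι_mul_mem_mul u ht
    -- Inserting `v` before, between and after the two vectors of a commutator gives six terms,
    -- which regroup into three commutators in front.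
    have e : shuffle v ((τ x * τ y - τ y * τ x) * t) =
        (τ v * τ x - τ x * τ v) * (τ y * t) - (τ v * τ y - τ y * τ v) * (τ x * t) +
          (τ x * τ y - τ y * τ x) * shuffle v t := by
      simp only [sub_mul, map_sub, mul_assoc, shuffle_ι_mul, mul_sub]
      abel
    rw [e]
    exact add_mem (sub_mem (Submodule.mul_mem_mul (commutator_mem _ _) (hι y))
      (Submodule.mul_mem_mul (commutator_mem _ _) (hι x)))
      (Submodule.mul_mem_mul (commutator_mem _ _) (shuffle_mem_tpow v ht))
  · simpa using add_mem hs ht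

/-- By induction through `mem_W_succ_succ`. For `t = u s` the difference `v t - v ∧ t` is `u (v ∧
s)`, so it lies in `V ⊗ W_{p+1}` by the inductive hypothesis; the leading relation is
`shuffle_mem_relSpace_mul`, or a bare commutator when `t` is a vector. -/
lemma shuffle_mem_W (v : V) {p : ℕ} {t : T} (ht : t ∈ W (symRel k V) p) :
    shuffle v t ∈ W (symRel k V) (p + 1) := by
  induction p generalizing t with
  | zero =>
    rw [W_zero, Submodule.mem_one] at ht
    obtain ⟨c, rfl⟩ := ht
    simpa [W_one, Algebra.algebraMap_eq_smul_one] using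
      Submodule.smul_mem _ c (LinearMap.mem_range_self τ v)
  | succ p ih =>
    apply mem_W_succ_succ
    · have h : τ v * t - shuffle v t ∈ LinearMap.range τ * W (symRel k V) (p + 1) := by
        refine W_succ_induction (fun u t ht => ?_) (fun s t hs ht => ?_) ht
        · simpa using ι_mul_mem_mul u (ih ht)
        ·
          rw [mul_add, map_add, add_sub_add_comm]
          exact add_mem hs ht
      simpa using sub_mem (ι_mul_mem_mul v ht) h
    · cases p with
      | zero =>
        rw [W_one] at ht
        obtain ⟨u, rfl⟩ := ht
        have := shuffle_ι_mul v u (1 : T)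
        rw [mul_one, shuffle_one] at this
        rw [this, tpow, pow_zero, mul_one]
        exact commutator_mem v u
      | succ p => exact shuffle_mem_relSpace_mul v (W_le_relSpace_mul _ _ ht)

/-- Proved directly on leading commutators, since anticommutation alone does not give it in
characteristic 2. -/
lemma contract_contract_self (φ : V →ₗ[k] k) {p : ℕ} {t : T} (ht : t ∈ W (symRel k V) p) :
    contract φ (contract φ t) = 0 := by
  match p, ht with
  | 0, ht => rw [contract_W_zero _ φ ht, map_zero]
  | 1, ht => exact contract_W_zero _ φ (contract_mem_W _ φ ht)
  | p + 2, ht =>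
    refine relSpace_mul_induction (fun x y t _ => ?_) (fun s t hs ht => ?_)
      (W_le_relSpace_mul _ _ ht)
    · simp [sub_mul, mul_assoc, smul_smul, mul_comm]
    · simp [hs, ht]

lemma contract_contract (φ ψ : V →ₗ[k] k) {p : ℕ} {t : T} (ht : t ∈ W (symRel k V) p) :
    contract φ (contract ψ t) = - contract ψ (contract φ t) := by
  match p, ht with
  | 0, ht => simp [contract_W_zero _ _ ht]
  | 1, ht => simp [contract_W_zero _ _ (contract_mem_W _ _ ht)]
  | p + 2, ht =>
    refine relSpace_mul_induction (fun x y t _ => ?_) (fun s t hs ht => ?_)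
      (W_le_relSpace_mul _ _ ht)
    · simp [sub_mul, mul_assoc, smul_smul, mul_comm]
    · simp only [map_add, hs, ht, neg_add]

/-- Expand each contraction again along its first factor, exchange the two contractions at the cost
of one sign, and use the inductive hypothesis on the inner sum. -/
lemma sum_contract_mul_ι {I : Type*} [Fintype I] (b : Module.Basis I k V) {p : ℕ} {t : T}
    (ht : t ∈ W (symRel k V) (p + 1)) :
    ∑ i, contract (b.coord i) t * τ (b i) = (-1 : k) ^ p • t := by
  induction p generalizing t with
  | zero =>
    rw [W_one] at ht
    obtain ⟨u, rfl⟩ := ht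
    simp only [contract_ι, ← Algebra.smul_def, ← map_smul, ← map_sum]
    simp [b.sum_repr]
  | succ p ih =>
    have h : ∀ j, contract (b.coord j) t =
        ∑ i, τ (b i) * contract (b.coord i) (contract (b.coord j) t) := fun j =>
      (sum_ι_mul_contract b (W_le _ _ (contract_mem_W _ _ ht))).symm
    calc ∑ j, contract (b.coord j) t * τ (b j)
        = ∑ j, ∑ i, τ (b i) * (contract (b.coord i) (contract (b.coord j) t) * τ (b j)) := by
          refine Finset.sum_congr rfl fun j _ => ?_
          conv_lhs => rw [h j, Finset.sum_mul]
          simp only [mul_assoc]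
      _ = - ∑ i, τ (b i) * ∑ j, contract (b.coord j) (contract (b.coord i) t) * τ (b j) := by
          rw [Finset.sum_comm, ← Finset.sum_neg_distrib]
          refine Finset.sum_congr rfl fun i _ => ?_
          rw [Finset.mul_sum, ← Finset.sum_neg_distrib]
          refine Finset.sum_congr rfl fun j _ => ?_
          rw [contract_contract _ _ ht, neg_mul, mul_neg]
      _ = (-1 : k) ^ (p + 1) • t := by
          simp only [ih (contract_mem_W _ _ ht), mul_smul_comm, ← Finset.smul_sum,
            sum_ι_mul_contract b (W_le _ _ ht), pow_succ]
          simp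

end Operators

/-! ### Division by a variable and vanishing of variables in `S(V)`. -/

section Division

variable {k : Type u} {V : Type v} [Field k] [AddCommGroup V] [Module k V] {I : Type*}
  (b : Module.Basis I k V)

local notation "A" => SymmetricAlgebra k V
local notation "x" => SymmetricAlgebra.ι k V

/-- Division by the basis vector `b m` in `S(V)`, dropping the monomials not divisible by it. -/
def divVar (m : I) : A →ₗ[k] A :=
  (SymmetricAlgebra.equivMvPolynomial b).symm.toLinearMap ∘ₗ
    { toFun := fun p => p.divMonomial (Finsupp.single m 1)
      map_add' := fun p q => MvPolynomial.add_divMonomial _ _ _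
      map_smul' := fun c p => by ext; simp [MvPolynomial.coeff_divMonomial] } ∘ₗ
    (SymmetricAlgebra.equivMvPolynomial b).toLinearMap

@[simp] lemma divVar_ι_mul_self (m : I) (a : A) : divVar b m (x (b m) * a) = a := by
  simp [divVar]

lemma divVar_ι_mul_of_ne {m i : I} (h : i ≠ m) (a : A) :
    divVar b m (x (b i) * a) = x (b i) * divVar b m a := by
  apply (SymmetricAlgebra.equivMvPolynomial b).injective
  simp only [divVar, LinearMap.comp_apply, AlgEquiv.toLinearMap_apply, LinearMap.coe_mk,
    AddHom.coe_mk, map_mul, AlgEquiv.apply_symm_apply,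
    SymmetricAlgebra.equivMvPolynomial_ι_apply]
  classical
  ext s
  simp only [MvPolynomial.coeff_divMonomial, MvPolynomial.coeff_X_mul']
  have h1 : i ∈ (Finsupp.single m 1 + s).support ↔ i ∈ s.support := by
    simp [h]
  simp only [h1]
  split_ifs with h2
  · congr 1
    rw [add_tsub_assoc_of_le]
    simpa [Nat.one_le_iff_ne_zero] using h2
  · rfl

@[simp] lemma divVar_algebraMap (m : I) (c : k) : divVar b m (algebraMap k A c) = 0 := by
  apply (SymmetricAlgebra.equivMvPolynomial b).injective
  simp only [divVar, LinearMap.comp_apply, AlgEquiv.toLinearMap_apply, LinearMap.coe_mk,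
    AddHom.coe_mk, AlgEquiv.commutes, AlgEquiv.apply_symm_apply, map_zero]
  classical
  ext s
  simp only [MvPolynomial.coeff_divMonomial, MvPolynomial.algebraMap_eq, MvPolynomial.coeff_C,
    MvPolynomial.coeff_zero]
  rw [if_neg]
  intro h
  have h' := DFunLike.congr_fun h m
  simp only [Finsupp.coe_zero, Pi.zero_apply, Finsupp.coe_add, Pi.add_apply,
    Finsupp.single_eq_same] at h'
  omega

/-- The map that sets the variable `b m` of `S(V)` to zero. -/
def evalZero (m : I) : A →ₗ[k] A :=
  LinearMap.id - LinearMap.mulLeft k (x (b m)) ∘ₗ divVar b m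

lemma evalZero_apply (m : I) (a : A) : evalZero b m a = a - x (b m) * divVar b m a := rfl

@[simp] lemma evalZero_ι_mul_self (m : I) (a : A) : evalZero b m (x (b m) * a) = 0 := by
  simp [evalZero_apply]

lemma evalZero_ι_mul_of_ne {m i : I} (h : i ≠ m) (a : A) :
    evalZero b m (x (b i) * a) = x (b i) * evalZero b m a := by
  simp only [evalZero_apply, divVar_ι_mul_of_ne b h]
  ring

@[simp] lemma evalZero_algebraMap (m : I) (c : k) :
    evalZero b m (algebraMap k A c) = algebraMap k A c := by
  simp [evalZero_apply]

/-- The map that sets the variables `b m`, for `m` in `L`, to zero. -/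
def evalZeros : List I → A →ₗ[k] A
  | [] => LinearMap.id
  | m :: L => evalZeros L ∘ₗ evalZero b m

@[simp] lemma evalZeros_algebraMap (L : List I) (c : k) :
    evalZeros b L (algebraMap k A c) = algebraMap k A c := by
  induction L with
  | nil => rfl
  | cons m L ih => simp [evalZeros, ih]

lemma evalZeros_ι_mul {i : I} {L : List I} (h : i ∈ L) (a : A) :
    evalZeros b L (x (b i) * a) = 0 := by
  induction L generalizing a with
  | nil => simp at h
  | cons m L ih =>
    by_cases hi : i = m
    · subst hi
      simp [evalZeros]
    · rw [evalZeros, LinearMap.comp_apply, evalZero_ι_mul_of_ne b hi, ih (by simpa [hi] using h)]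

/-- Constants are fixed and every multiple of a variable is killed, which leaves only the constant
term. -/
lemma evalZeros_eq_augmentation {L : List I} (h : ∀ i, i ∈ L) (a : A) :
    evalZeros b L a = algebraMap k A (SymmetricAlgebra.algebraMapInv a) := by
  obtain ⟨q, rfl⟩ := (SymmetricAlgebra.equivMvPolynomial b).symm.surjective a
  induction q using MvPolynomial.induction_on with
  | C c =>
    rw [← MvPolynomial.algebraMap_eq, AlgEquiv.commutes, evalZeros_algebraMap,
      SymmetricAlgebra.algebraMap_leftInverse]
  | add p q hp hq => simp only [map_add, hp, hq]
  | mul_X p i _ =>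
    rw [map_mul, mul_comm, SymmetricAlgebra.equivMvPolynomial_symm_X, evalZeros_ι_mul b (h i),
      map_mul, SymmetricAlgebra.algebraMapInv_ι, zero_mul, map_zero]

end Division

/-! ### Iterated contractions and shuffles, and the part divisible by all basis vectors. -/

section TopForm

variable {k : Type u} {V : Type v} [Field k] [AddCommGroup V] [Module k V] {I : Type*}
  (b : Module.Basis I k V)

local notation "T" => TensorAlgebra k V
local notation "τ" => TensorAlgebra.ι k (M := V)

/-- Contraction with the coordinate forms indexed by `L`. -/
def contractList : List I → T →ₗ[k] T
  | [] => LinearMap.id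
  | m :: L => contract (b.coord m) ∘ₗ contractList L

/-- Signed shuffle product with the basis vectors indexed by `L`. -/
def shuffleList : List I → T →ₗ[k] T
  | [] => LinearMap.id
  | m :: L => shuffle (b m) ∘ₗ shuffleList L

/-- The projection of antisymmetric tensors onto those divisible by `b m`. -/
def divisiblePart (m : I) : T →ₗ[k] T := shuffle (b m) ∘ₗ contract (b.coord m)

/-- The projection of antisymmetric tensors onto those divisible by `b m` for all `m` in `L`. -/
def divisiblePartList : List I → T →ₗ[k] T
  | [] => LinearMap.id
  | m :: L => divisiblePart b m ∘ₗ divisiblePartList L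

lemma contractList_mem_W {L : List I} {p : ℕ} {t : T} (ht : t ∈ W (symRel k V) (p + L.length)) :
    contractList b L t ∈ W (symRel k V) p := by
  induction L generalizing p with
  | nil => exact ht
  | cons m L ih =>
    refine contract_mem_W _ _ (ih ?_)
    rwa [add_assoc, add_comm 1]

lemma contractList_eq_zero {L : List I} {p : ℕ} (hp : p < L.length) {t : T}
    (ht : t ∈ W (symRel k V) p) : contractList b L t = 0 := by
  induction L with
  | nil => simp at hp
  | cons m L ih =>
    rw [contractList, LinearMap.comp_apply]
    rcases Nat.lt_succ_iff_lt_or_eq.1 hp with h | rfl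
    · rw [ih h, map_zero]
    · exact contract_W_zero _ _ (contractList_mem_W b (by simpa using ht))

/-- Anticommutation of contractions needs membership in some `W_q`, whatever `q` is; this spares
comparing the degree with the length of `L`. -/
lemma contractList_mem_W_of_mem {L : List I} {p : ℕ} {t : T} (ht : t ∈ W (symRel k V) p) :
    ∃ q, contractList b L t ∈ W (symRel k V) q := by
  by_cases h : p < L.length
  · exact ⟨0, by simp [contractList_eq_zero b h ht]⟩
  · refine ⟨p - L.length, contractList_mem_W b ?_⟩
    rwa [Nat.sub_add_cancel (not_lt.1 h)]

lemma contract_contractList {i : I} {L : List I} (hi : i ∈ L) {p : ℕ} {t : T}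
    (ht : t ∈ W (symRel k V) p) : contract (b.coord i) (contractList b L t) = 0 := by
  induction L with
  | nil => simp at hi
  | cons m L ih =>
    obtain ⟨q, hq⟩ := contractList_mem_W_of_mem b (L := L) ht
    rw [contractList, LinearMap.comp_apply]
    by_cases h : i = m
    · subst h
      exact contract_contract_self _ hq
    · rw [contract_contract _ _ hq, ih (by simpa [h] using hi), map_zero, neg_zero]

lemma contractList_contract {i : I} {L : List I} (hi : i ∈ L) {p : ℕ} {t : T}
    (ht : t ∈ W (symRel k V) p) : contractList b L (contract (b.coord i) t) = 0 := by
  have h : ∀ L : List I, contractList b L (contract (b.coord i) t) =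
      (-1 : k) ^ L.length • contract (b.coord i) (contractList b L t) := by
    intro L
    induction L with
    | nil => simp [contractList]
    | cons m L ih =>
      obtain ⟨q, hq⟩ := contractList_mem_W_of_mem b (L := L) ht
      simp only [contractList, LinearMap.comp_apply, ih, map_smul, List.length_cons, pow_succ]
      rw [contract_contract _ _ hq]
      simp
  rw [h, contract_contractList b hi ht, smul_zero]

/-- The result still has positive degree and all its coordinate contractions vanish, so it is zero
by `sum_ι_mul_contract`. -/
lemma contractList_eq_zero_of_lt [Fintype I] {L : List I} (hL : ∀ i, i ∈ L) {p : ℕ}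
    (hp : L.length < p) {t : T} (ht : t ∈ W (symRel k V) p) : contractList b L t = 0 := by
  obtain ⟨q, rfl⟩ := Nat.exists_eq_add_of_lt hp
  have h : contractList b L t ∈ W (symRel k V) (q + 1) :=
    contractList_mem_W b (by
      rwa [show L.length + q + 1 = q + 1 + L.length by omega] at ht)
  rw [← sum_ι_mul_contract b (W_le _ _ h)]
  exact Finset.sum_eq_zero fun i _ => by rw [contract_contractList b (hL i) ht, mul_zero]

lemma shuffleList_mem_W (L : List I) {p : ℕ} {t : T} (ht : t ∈ W (symRel k V) p) :
    shuffleList b L t ∈ W (symRel k V) (p + L.length) := by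
  induction L with
  | nil => exact ht
  | cons m L ih => exact shuffle_mem_W _ ih

lemma contract_shuffleList {i : I} {L : List I} (hi : i ∉ L) (t : T) :
    contract (b.coord i) (shuffleList b L t) =
      (-1 : k) ^ L.length • shuffleList b L (contract (b.coord i) t) := by
  induction L with
  | nil => simp [shuffleList]
  | cons m L ih =>
    rw [List.mem_cons, not_or] at hi
    simp only [shuffleList, LinearMap.comp_apply, contract_shuffle, ih hi.2, List.length_cons,
      pow_succ, map_smul, b.coord_apply, b.repr_self, Finsupp.single_eq_of_ne hi.1]
    simp

/-- For distinct indices, contractions move past the remaining shuffles up to sign, so the composite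
of projections becomes all contractions followed by all shuffles. The scalar is only a sign, and its
value is never needed. -/
lemma divisiblePartList_eq {L : List I} (hL : L.Nodup) :
    ∃ c : k, ∀ t : T, divisiblePartList b L t = c • shuffleList b L (contractList b L t) := by
  induction L with
  | nil => exact ⟨1, fun t => by simp [divisiblePartList, shuffleList, contractList]⟩
  | cons m L ih =>
    rw [List.nodup_cons] at hL
    obtain ⟨c, hc⟩ := ih hL.2
    refine ⟨c * (-1) ^ L.length, fun t => ?_⟩
    simp only [divisiblePartList, divisiblePart, shuffleList, contractList, LinearMap.comp_apply,
      hc, map_smul, contract_shuffleList b hL.1, smul_smul]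

lemma contractList_shuffle {i : I} {L : List I} (hi : i ∉ L) (t : T) :
    contractList b L (shuffle (b i) t) =
      (-1 : k) ^ L.length • shuffle (b i) (contractList b L t) := by
  induction L with
  | nil => simp [contractList]
  | cons m L ih =>
    rw [List.mem_cons, not_or] at hi
    simp only [contractList, LinearMap.comp_apply, contract_shuffle, ih hi.2, List.length_cons,
      pow_succ, map_smul, b.coord_apply, b.repr_self, Finsupp.single_eq_of_ne (Ne.symm hi.1)]
    simp

/-- The constant produced is a sign, not a factorial, hence nonzero in every characteristic. -/
lemma exists_contractList_shuffleList {L : List I} (hL : L.Nodup) :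
    ∃ c : k, c ≠ 0 ∧ contractList b L (shuffleList b L 1) = algebraMap k T c := by
  induction L with
  | nil => exact ⟨1, one_ne_zero, by simp [shuffleList, contractList]⟩
  | cons m L ih =>
    rw [List.nodup_cons] at hL
    obtain ⟨c, hc, h⟩ := ih hL.2
    refine ⟨(-1) ^ L.length * c, mul_ne_zero (by simp) hc, ?_⟩
    simp only [contractList, shuffleList, LinearMap.comp_apply, contractList_shuffle b hL.1, h,
      map_smul, contract_shuffle]
    simp [Algebra.algebraMap_eq_smul_one, smul_smul]

lemma divisiblePart_mem_W (m : I) {p : ℕ} {t : T} (ht : t ∈ W (symRel k V) p) :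
    divisiblePart b m t ∈ W (symRel k V) p := by
  cases p with
  | zero => simp [divisiblePart, contract_W_zero _ _ ht]
  | succ p => exact shuffle_mem_W _ (contract_mem_W _ _ ht)

lemma divisiblePartList_mem_W (L : List I) {p : ℕ} {t : T} (ht : t ∈ W (symRel k V) p) :
    divisiblePartList b L t ∈ W (symRel k V) p := by
  induction L with
  | nil => exact ht
  | cons m L ih => exact divisiblePart_mem_W b m ih

end TopForm

/-! ### The Koszul complex of `S(V)`: vanishing of `b_K` and elimination of variables. -/

section Cochains

variable {k : Type u} {V : Type v} [Field k] [AddCommGroup V] [Module k V] {I : Type*}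
  (b : Module.Basis I k V)

local notation "T" => TensorAlgebra k V
local notation "τ" => TensorAlgebra.ι k (M := V)
local notation "A" => SymmetricAlgebra k V
local notation "x" => SymmetricAlgebra.ι k V
local notation "P" => symmetricPresentation k V

/-- Contraction `W_{p+1} → W_p`. -/
def contractW (φ : V →ₗ[k] k) (p : ℕ) : W (symRel k V) (p + 1) →ₗ[k] W (symRel k V) p :=
  (contract φ).restrict fun _ => contract_mem_W _ φ

/-- Signed shuffle product `W_p → W_{p+1}`. -/
def shuffleW (v : V) (p : ℕ) : W (symRel k V) p →ₗ[k] W (symRel k V) (p + 1) :=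
  (shuffle v).restrict fun _ => shuffle_mem_W v

/-- The restriction of `divisiblePartList` to `W_p`. -/
def divisiblePartW (L : List I) (p : ℕ) : W (symRel k V) p →ₗ[k] W (symRel k V) p :=
  (divisiblePartList b L).restrict fun _ => divisiblePartList_mem_W b L

lemma fundamental_apply (u : V) (hu : τ u ∈ W (symRel k V) 1) :
    (P).fundamental ⟨τ u, hu⟩ = x u := rfl

lemma ι_mem_W_one (u : V) : τ u ∈ W (symRel k V) 1 := by
  rw [W_one]; exact LinearMap.mem_range_self _ u

/-- The product of the basis vectors in `W_n`. -/
def topForm (L : List I) : W (symRel k V) L.length :=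
  ⟨shuffleList b L 1, by
    simpa using shuffleList_mem_W b L (p := 0) (by rw [W_zero]; exact Submodule.one_le.1 le_rfl)⟩

/-- The constant term of the value of a cochain at the product of the basis vectors. -/
def residue (L : List I) : (P).Cochain L.length →ₗ[k] k :=
  SymmetricAlgebra.algebraMapInv.toLinearMap ∘ₗ LinearMap.applyₗ (topForm b L)

lemma residue_apply (L : List I) (f : (P).Cochain L.length) :
    residue b L f = SymmetricAlgebra.algebraMapInv (f (topForm b L)) := rfl

lemma divisiblePartW_apply_eq_smul {L : List I} (hL : L.Nodup) (w : W (symRel k V) L.length) :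
    ∃ c : k, divisiblePartW b L L.length w = c • topForm b L := by
  obtain ⟨c, hc⟩ := divisiblePartList_eq b hL
  have h : contractList b L (w : T) ∈ W (symRel k V) 0 := contractList_mem_W b (by simp)
  rw [W_zero, Submodule.mem_one] at h
  obtain ⟨a, ha⟩ := h
  refine ⟨c * a, Subtype.ext ?_⟩
  change divisiblePartList b L (w : T) = (c * a) • shuffleList b L 1
  rw [hc, ← ha, Algebra.algebraMap_eq_smul_one, map_smul, smul_smul]

variable [Fintype I]

lemma concat_fundamental_left (p : ℕ) (f : (P).Cochain p) (w : W (symRel k V) (p + 1)) :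
    (P).concat (Nat.add_comm 1 p) (P).fundamental f w =
      ∑ i, x (b i) * f (contractW (b.coord i) p w) := by
  rw [(P).concat_apply_of_eq (Nat.add_comm 1 p) _ _ w
    -- The splitting of `w` in `W_1 ⊗ W_p` is made explicit by expanding the first factor of `w` in
    -- the basis.
    (∑ i, (⟨τ (b i), ι_mem_W_one _⟩ : W (symRel k V) 1) ⊗ₜ contractW (b.coord i) p w)]
  · simp [fundamental_apply]
  · rw [map_sum]
    exact sum_ι_mul_contract b (W_le _ _ w.2)

lemma concat_fundamental_right (p : ℕ) (f : (P).Cochain p) (w : W (symRel k V) (p + 1)) :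
    (P).concat rfl f (P).fundamental w =
      (-1 : k) ^ p • ∑ i, x (b i) * f (contractW (b.coord i) p w) := by
  rw [(P).concat_apply_of_eq rfl _ _ w
    ((-1 : k) ^ p • ∑ i, contractW (b.coord i) p w ⊗ₜ
      (⟨τ (b i), ι_mem_W_one _⟩ : W (symRel k V) 1))]
  · simp [fundamental_apply, mul_comm]
  · rw [map_smul, map_sum]
    have h := sum_contract_mul_ι b w.2
    change (-1 : k) ^ p • ∑ i, contract (b.coord i) (w : T) * τ (b i) = w
    rw [h, smul_smul, ← mul_pow]
    simp

/-- In a commutative algebra the two terms of `b_K f` are the same sum with the same sign `(-1)^p`.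
-/
lemma bK_eq_zero (b : Module.Basis I k V) (p : ℕ) : (P).bK p = 0 := by
  ext f w
  simp only [QuadraticPresentation.bK, LinearMap.coe_mk, AddHom.coe_mk, LinearMap.sub_apply,
    LinearMap.smul_apply, concat_fundamental_left b,
    concat_fundamental_right b, sub_self, LinearMap.zero_apply]

lemma cupE_apply (p : ℕ) (f : (P).Cochain p) (w : W (symRel k V) (p + 1)) :
    (P).cupE p f w = (-1 : k) ^ p • ∑ i, x (b i) * f (contractW (b.coord i) p w) := by
  simp only [QuadraticPresentation.cupE, QuadraticPresentation.cup, LinearMap.coe_mk,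
    AddHom.coe_mk, LinearMap.smul_apply, concat_fundamental_left b, one_mul]

lemma sum_ι_mul_comp_contract_of_cocycle {p : ℕ} {f : (P).Cochain p} (hf : (P).cupE p f = 0)
    (w : W (symRel k V) (p + 1)) : ∑ i, x (b i) * f (contractW (b.coord i) p w) = 0 := by
  have h := cupE_apply b p f w
  rw [hf, LinearMap.zero_apply] at h
  exact (smul_eq_zero_iff_right (by simp)).1 h.symm

/-- The composition of a cochain with `divisiblePart` and with `evalZero`. -/
def reduce (m : I) (p : ℕ) (f : (P).Cochain p) : (P).Cochain p :=
  evalZero b m ∘ₗ f ∘ₗ (divisiblePart b m).restrict fun _ => divisiblePart_mem_W b m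

/-- The homotopy for the variable `x_m` is `f ↦ divVar_m ∘ f ∘ (b_m ∧ -)`. The cocycle equation at
`b_m ∧ w` reads `x_m f(w) = ∑ x_i f(b_m ∧ ι_i w)`; dividing by `x_m` gives `f(w)` as a coboundary
plus the remainder of the term `i = m`, which is `reduce`. -/
lemma sub_reduce_mem_boundaries (m : I) {p : ℕ} {f : (P).Cochain p} (hf : (P).cupE p f = 0) :
    f - reduce b m p f ∈ boundaries (P).cupE p := by
  classical
  have hd := sum_ι_mul_comp_contract_of_cocycle b hf
  have hw : ∀ w : W (symRel k V) p, ∑ i, x (b i) * f (contractW (b.coord i) p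
      (shuffleW (b m) p w)) = 0 := fun w => hd _
  -- Division commutes with the other variables; for `i = m` the correction is the remainder in `a =
  -- x_m (a / x_m) + a|_{x_m = 0}`.
  have hdiv : ∀ (i : I) (a : A), divVar b m (x (b i) * a) =
      x (b i) * divVar b m a + if i = m then evalZero b m a else 0 := by
    intro i a
    split_ifs with h
    · subst h; simp [evalZero_apply]
    · rw [divVar_ι_mul_of_ne b h, add_zero]
  cases p with
  | zero =>
    -- There are no nonzero boundaries in degree 0. Here the cocycle equation says `x_m f(w) = 0`,
    -- so `f = 0`, and `reduce` vanishes as contractions kill `W_0`.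
    suffices h : f - reduce b m 0 f = 0 by rw [h]; exact Submodule.zero_mem _
    ext w
    have h1 : ∀ i, contractW (b.coord i) 0 (shuffleW (b m) 0 w) = b.coord i (b m) • w := by
      intro i
      apply Subtype.ext
      change contract (b.coord i) (shuffle (b m) (w : T)) = b.coord i (b m) • (w : T)
      rw [contract_shuffle, contract_W_zero _ _ w.2, map_zero, sub_zero]
    have h2 : reduce b m 0 f w = 0 := by
      have : (divisiblePart b m).restrict (fun _ => divisiblePart_mem_W b m) w = 0 := by
        apply Subtype.ext
        change shuffle (b m) (contract (b.coord m) (w : T)) = 0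
        rw [contract_W_zero _ _ w.2, map_zero]
      simp only [reduce, LinearMap.comp_apply, this, map_zero]
    have h3 := congrArg (divVar b m) (hw w)
    simp only [h1, map_smul, mul_smul_comm, b.coord_apply, b.repr_self] at h3
    rw [LinearMap.sub_apply, h2, sub_zero, LinearMap.zero_apply]
    simpa [Finsupp.single_apply] using h3
  | succ p =>
    -- The sign cancels the one in `cupE_apply`.
    refine ⟨(-1 : k) ^ p • (divVar b m ∘ₗ f ∘ₗ shuffleW (b m) p), ?_⟩
    ext w
    rw [cupE_apply b]
    have h1 : ∀ i, contractW (b.coord i) (p + 1) (shuffleW (b m) (p + 1) w) =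
        b.coord i (b m) • w - shuffleW (b m) p (contractW (b.coord i) p w) := fun i =>
      Subtype.ext (contract_shuffle _ _ _)
    have h2 : ∀ i, divVar b m (x (b i) * f (contractW (b.coord i) (p + 1)
        (shuffleW (b m) (p + 1) w))) = (if i = m then f w else 0) -
        (x (b i) * divVar b m (f (shuffleW (b m) p (contractW (b.coord i) p w))) +
          if i = m then evalZero b m (f (shuffleW (b m) p (contractW (b.coord i) p w)))
            else 0) := by
      intro i
      rw [h1, map_sub, mul_sub, map_sub, hdiv i (f (shuffleW _ _ _)), map_smul, mul_smul_comm,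
        map_smul, b.coord_apply, b.repr_self]
      congr 1
      split_ifs with h
      · subst h; simp
      · simp [Ne.symm h]
    have h3 := congrArg (divVar b m) (hw w)
    simp only [map_sum, map_zero, h2, Finset.sum_sub_distrib, Finset.sum_add_distrib,
      Finset.sum_ite_eq', Finset.mem_univ, if_true, sub_eq_zero] at h3
    rw [LinearMap.sub_apply, h3]
    simp only [LinearMap.smul_apply, LinearMap.comp_apply, mul_smul_comm, ← Finset.smul_sum,
      smul_smul, ← mul_pow]
    rw [neg_one_mul, neg_neg, one_pow, one_smul]
    exact (add_sub_cancel_right _ _).symm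

/-- Each reduction of a cocycle differs from it by a boundary, so it is again a cocycle and the next
variable can be eliminated. -/
lemma sub_evalZeros_comp_mem_boundaries (L : List I) {p : ℕ} {f : (P).Cochain p}
    (hf : (P).cupE p f = 0) :
    f - evalZeros b L ∘ₗ f ∘ₗ divisiblePartW b L p ∈ boundaries (P).cupE p := by
  induction L generalizing f with
  | nil =>
    have h : f - evalZeros b [] ∘ₗ f ∘ₗ divisiblePartW b [] p = 0 := sub_self f
    rw [h]
    exact Submodule.zero_mem _
  | cons m L ih =>
    have h1 := sub_reduce_mem_boundaries b m hf
    have h2 : ∀ g ∈ boundaries (P).cupE p, (P).cupE p g = 0 := by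
      intro g hg
      cases p with
      | zero =>
        obtain rfl : g = 0 := hg
        exact map_zero _
      | succ p =>
        obtain ⟨l, rfl⟩ := hg
        exact (P).cupE_cupE p l
    have h3 : (P).cupE p (reduce b m p f) = 0 := by
      have := h2 _ h1
      rwa [map_sub, hf, zero_sub, neg_eq_zero] at this
    have h4 := add_mem h1 (ih h3)
    rwa [sub_add_sub_cancel] at h4

/-- Below the top degree there are too few factors to contract; above it, too few basis vectors. -/
lemma divisiblePartW_eq_zero {L : List I} (hL : L.Nodup) (hL' : ∀ i, i ∈ L) {p : ℕ}
    (hp : p ≠ L.length) : divisiblePartW b L p = 0 := by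
  ext w
  obtain ⟨c, hc⟩ := divisiblePartList_eq b hL
  change divisiblePartList b L (w : T) = 0
  rw [hc]
  rcases hp.lt_or_gt with h | h
  · rw [contractList_eq_zero b h w.2, map_zero, smul_zero]
  · rw [contractList_eq_zero_of_lt b hL' h w.2, map_zero, smul_zero]

lemma mem_boundaries_of_cocycle (b : Module.Basis I k V) {L : List I} (hL : L.Nodup)
    (hL' : ∀ i, i ∈ L) {p : ℕ} (hp : p ≠ L.length) {f : (P).Cochain p} (hf : (P).cupE p f = 0) :
    f ∈ boundaries (P).cupE p := by
  simpa [divisiblePartW_eq_zero b hL hL' hp] using sub_evalZeros_comp_mem_boundaries b L hf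

/-- The fully reduced cocycle is determined by the residue, as divisible parts are multiples of the
top form. Conversely, coboundaries take values in the ideal generated by the variables. -/
lemma residue_eq_zero_iff {L : List I} (hL : L.Nodup) (hL' : ∀ i, i ∈ L)
    {f : (P).Cochain L.length} (hf : (P).cupE L.length f = 0) :
    residue b L f = 0 ↔ f ∈ boundaries (P).cupE L.length := by
  constructor
  · intro h
    have h1 := sub_evalZeros_comp_mem_boundaries b L hf
    have h2 : evalZeros b L ∘ₗ f ∘ₗ divisiblePartW b L L.length = 0 := by
      ext w
      obtain ⟨c, hc⟩ := divisiblePartW_apply_eq_smul b hL w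
      rw [LinearMap.comp_apply, LinearMap.comp_apply, hc, map_smul, map_smul,
        evalZeros_eq_augmentation b hL', ← residue_apply, h, map_zero, smul_zero,
        LinearMap.zero_apply]
    rwa [h2, sub_zero] at h1
  · clear hf
    -- The degree is generalized because `boundaries` is defined by cases on it and `L.length` is
    -- neither `0` nor a successor syntactically.
    have key : ∀ p (f : (P).Cochain p) (w : W (symRel k V) p), f ∈ boundaries (P).cupE p →
        SymmetricAlgebra.algebraMapInv (f w) = 0 := by
      rintro (_ | p) f w hf
      · obtain rfl : f = 0 := hf
        simp
      · obtain ⟨g, rfl⟩ := hf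
        rw [cupE_apply b]
        simp [SymmetricAlgebra.algebraMapInv_ι]
    exact key _ f _

/-- The witness is the constant-valued cochain given by contracting with all coordinates. It is a
cocycle because one further contraction repeats an index. -/
lemma exists_cocycle_residue_ne_zero {L : List I} (hL : L.Nodup) (hL' : ∀ i, i ∈ L) :
    ∃ f : (P).Cochain L.length, (P).cupE L.length f = 0 ∧ residue b L f ≠ 0 := by
  obtain ⟨c, hc, h⟩ := exists_contractList_shuffleList b hL
  refine ⟨Algebra.linearMap k A ∘ₗ TensorAlgebra.algebraMapInv.toLinearMap ∘ₗ
    contractList b L ∘ₗ Submodule.subtype _, ?_, ?_⟩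
  · ext w
    have hw : ∀ i, contractList b L (contractW (b.coord i) L.length w : T) = 0 := fun i =>
      contractList_contract b (hL' i) w.2
    rw [cupE_apply b]
    simp [hw]
  · have h' : contractList b L (topForm b L : T) = algebraMap k T c := h
    simpa [residue_apply, h', TensorAlgebra.algebraMap_leftInverse V c,
      SymmetricAlgebra.algebraMap_leftInverse V c] using hc

end Cochains

/-! ### Transport from cochains to Koszul cohomology. -/

section Cohomology

variable {k : Type u} {V : Type v} [Field k] [AddCommGroup V] [Module k V]

local notation "P" => symmetricPresentation k V

/-- As `b_K = 0`, the Koszul cohomology of `S(V)` is the space of Koszul cochains. -/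
def HKEquiv (h : ∀ p, (P).bK p = 0) (p : ℕ) : (P).HK p ≃ₗ[k] (P).Cochain p :=
  (Submodule.quotEquivOfEqBot _ (by
    rw [Submodule.submoduleOf, eq_bot_iff]
    rintro ⟨f, hf⟩ hfb
    cases p with
    | zero => exact Subtype.ext hfb
    | succ p =>
      obtain ⟨g, rfl⟩ := hfb
      exact Subtype.ext (by simp [h]))).trans
    (LinearEquiv.ofTop _ (by rw [h, LinearMap.ker_zero]))

lemma HKEquiv_cupDiff (h : ∀ p, (P).bK p = 0) (p : ℕ) (α : (P).HK p) :
    HKEquiv h (p + 1) ((P).cupDiff p α) = (P).cupE p (HKEquiv h p α) := by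
  obtain ⟨f, rfl⟩ := Submodule.Quotient.mk_surjective _ α
  rfl

lemma HKEquiv_mem_boundaries_iff (h : ∀ p, (P).bK p = 0) (p : ℕ) (α : (P).HK p) :
    HKEquiv h p α ∈ boundaries (P).cupE p ↔ α ∈ boundaries (P).cupDiff p := by
  cases p with
  | zero => exact (HKEquiv h 0).map_eq_zero_iff
  | succ p =>
    constructor
    · rintro ⟨g, hg⟩
      refine ⟨(HKEquiv h p).symm g, (HKEquiv h (p + 1)).injective ?_⟩
      rw [HKEquiv_cupDiff, LinearEquiv.apply_symm_apply, hg]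
    · rintro ⟨β, rfl⟩
      exact ⟨HKEquiv h p β, (HKEquiv_cupDiff h p β).symm⟩

lemma cupE_HKEquiv (h : ∀ p, (P).bK p = 0) (p : ℕ) (α : LinearMap.ker ((P).cupDiff p)) :
    (P).cupE p (HKEquiv h p α) = 0 := by
  rw [← HKEquiv_cupDiff, α.2, map_zero]

end Cohomology

end KoszulCalculus

end

theorem mainTheorem10 {k : Type*} {V : Type*} [Field k] [AddCommGroup V] [Module k V]
    [FiniteDimensional k V] (n : ℕ) (hn : Module.finrank k V = n) :
    Nonempty ((KoszulCalculus.symmetricPresentation k V).HKhi n ≃ₗ[k] k) ∧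
      ∀ p : ℕ, p ≠ n → Subsingleton ((KoszulCalculus.symmetricPresentation k V).HKhi p) := by
  open KoszulCalculus in
  let b := Module.finBasis k V
  obtain ⟨L, hL, hL', hn'⟩ : ∃ L : List (Fin (Module.finrank k V)),
      L.Nodup ∧ (∀ i, i ∈ L) ∧ L.length = n :=
    ⟨List.finRange _, List.nodup_finRange _, List.mem_finRange, by rw [List.length_finRange, hn]⟩
  clear hn
  subst hn'
  have h := bK_eq_zero b
  constructor
  -- The residue on `∂_⌣`-cocycles has the boundaries as kernel, so it induces the isomorphism with
  -- `k`.
  · let Φ := residue b L ∘ₗ (HKEquiv h L.length).toLinearMap ∘ₗ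
      (LinearMap.ker ((symmetricPresentation k V).cupDiff L.length)).subtype
    have hΦ : LinearMap.ker Φ =
        (boundaries (symmetricPresentation k V).cupDiff L.length).submoduleOf _ := by
      ext α
      rw [LinearMap.mem_ker]
      exact (residue_eq_zero_iff b hL hL' (cupE_HKEquiv h _ α)).trans
        (HKEquiv_mem_boundaries_iff h _ _)
    have hs : Function.Surjective Φ := by
      obtain ⟨f, hf, hf'⟩ := exists_cocycle_residue_ne_zero b hL hL'
      -- A nonzero linear form is surjective, so one cocycle with nonzero residue suffices.
      refine LinearMap.surjective fun h0 => hf' ?_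
      have hα : (symmetricPresentation k V).cupDiff L.length ((HKEquiv h L.length).symm f) = 0 := by
        apply (HKEquiv h (L.length + 1)).injective
        rw [HKEquiv_cupDiff, LinearEquiv.apply_symm_apply, hf, map_zero]
      simpa [Φ] using DFunLike.congr_fun h0 ⟨_, hα⟩
    exact ⟨(Submodule.quotEquivOfEq _ _ hΦ.symm).trans (Φ.quotKerEquivOfSurjective hs)⟩
  · intro p hp
    rw [Submodule.Quotient.subsingleton_iff, Submodule.submoduleOf_eq_top]
    intro α hα
    rw [← HKEquiv_mem_boundaries_iff h]
    exact mem_boundaries_of_cocycle b hL hL' hp (cupE_HKEquiv h p ⟨α, hα⟩)
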